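/- Let $q,a,w\in\mathbb{C}$ with $|q|<1$, $|q|<|a|$ (that is, $a\neq 0$ and $|q/a|<1$) and $w\ne 0$. Fix any square roots $q^{1/2}$ of $q$ and $a^{1/2}$ of $a$, write $q^{1/2+|k|/2}=(q^{1/2})^{1+|k|}$, $a^{|k|/2}=(a^{1/2})^{|k|}$, $a^{-1/2}=(a^{1/2})^{-1}$, and assume $|a^{1/2}w|<1$ and $|a^{1/2}w^{-1}|<1$. (In the physical notation $a=q^{1-h}$.) Put $(z;q)_\infty=\prod_{j=0}^\infty(1-zq^j)$ and $(cz^{\pm1};q)_\infty=(cz;q)_\infty(cz^{-1};q)_\infty$, and let $\mathbb{T}$ be the positively oriented unit circle. Define the electric index $$I_{e,N_f=1;h;w}=\sum_{k\in\mathbb{Z}}a^{|k|/2}\,w^k\int_{\mathbb{T}}\frac{(a^{1/2}q^{1/2+|k|/2}z^{\pm1};q)_\infty}{(a^{-1/2}q^{1/2+|k|/2}z^{\pm1};q)_\infty}\,\frac{dz}{2\pi i z}$$ and the mirror (magnetic) index $$I_{m,N_f=1;h;w}=\frac{(a;q)_\infty}{(q/a;q)_\infty}\,\frac{(q w^{\pm1}/a^{1/2};q)_\infty}{(a^{1/2}w^{\pm1};q)_\infty}.$$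 Then each of the integrals exists, the sum over $k$ converges absolutely, and $$I_{e,N_f=1;h;w}=I_{m,N_f=1;h;w}.$$ -/

import Mathlib

open scoped Real

noncomputable section

/-- The infinite `q`-product `(z;q)_∞ = ∏_{j ≥ 0} (1 - z q^j)`, for `|q| < 1`. -/
def qPochInf (z q : ℂ) : ℂ := ∏' j : ℕ, (1 - z * q ^ j)

/-- For `|q| < 1` the infinite product defining `(z;q)_∞` converges. -/
theorem multipliable_qPochInf (z : ℂ) {q : ℂ} (hq : ‖q‖ < 1) :
    Multipliable (fun j : ℕ => 1 - z * q ^ j) := by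
  have h : Summable (fun j : ℕ => ‖-(z * q ^ j)‖) := by
    simpa [norm_mul, norm_pow] using
      (summable_geometric_of_lt_one (norm_nonneg q) hq).mul_left ‖z‖
  simpa [sub_eq_add_neg] using multipliable_one_add_of_summable h

/-- The shorthand `(c z^{±1};q)_∞ = (c z;q)_∞ (c z⁻¹;q)_∞`. -/
def qPochInfPM (c z q : ℂ) : ℂ := qPochInf (c * z) q * qPochInf (c * z⁻¹) q

/-- The electric integrand in flux sector `k`,
`(a^{1/2} q^{1/2+|k|/2} z^{±1};q)_∞ / (a^{-1/2} q^{1/2+|k|/2} z^{±1};q)_∞`.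
Here `s` stands for `q^{1/2}` and `r` for `a^{1/2}`, so `q^{1/2+|k|/2} = s^{1+|k|}`. -/
def electricIntegrand (q s r : ℂ) (k : ℤ) (z : ℂ) : ℂ :=
  qPochInfPM (r * s ^ (1 + k.natAbs)) z q / qPochInfPM (r⁻¹ * s ^ (1 + k.natAbs)) z q

/-- The contribution of flux `k` to the electric index,
`a^{|k|/2} w^k ∫_𝕋 (electric integrand) dz / (2 π i z)`. -/
def electricTerm (q s r w : ℂ) (k : ℤ) : ℂ :=
  r ^ k.natAbs * w ^ k *
    ((2 * π * Complex.I)⁻¹ * ∮ z in C(0, 1), electricIntegrand q s r k z / z)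

/-- The electric index `I_{e,N_f=1;h;w}`, a sum over all fluxes `k ∈ ℤ`. -/
def electricIndex (q s r w : ℂ) : ℂ := ∑' k : ℤ, electricTerm q s r w k

/-- The mirror index `I_{m,N_f=1;h;w}`,
`(a;q)_∞ / (q/a;q)_∞ · (q w^{±1} / a^{1/2};q)_∞ / (a^{1/2} w^{±1};q)_∞`, with `r` for `a^{1/2}`. -/
def mirrorIndex (q a r w : ℂ) : ℂ :=
  qPochInf a q / qPochInf (q / a) q * (qPochInfPM (q / r) w q / qPochInfPM r w q)

end

open Filter Topology Finset

/-! Write `b n = (a;q)_n / (q;q)_n`, `b' n = (q/a;q)_n / (q;q)_n` and `t = a^{-1/2} q^{1/2+|k|/2}`;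
here `|t| < 1` because `|q| < |a|`. By the `q`-binomial theorem (`tsum_qBinomCoeff_mul_pow`) the
integrand is `(∑ b n (t z)^n)(∑ b n (t/z)^n)`, so the integral is its constant term `∑ (b n)^2
t^{2n}`. Heine's transformation (`tsum_qBinomCoeff_sq`) turns this into `(a;q)_∞/(q/a;q)_∞ · ∑ b' m
b' (m+|k|) a^m`. Times `a^{|k|/2}`, that sum is the coefficient of `w^k` in `(∑ b' n (a^{1/2}
w)^n)(∑ b' n (a^{1/2}/w)^n)`. Summing over `k` and applying the `q`-binomial theorem again gives the
mirror index. -/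

/-- The coefficient `(α;q)_n / (q;q)_n` of the `q`-binomial series. -/
noncomputable def qBinomCoeff (α q : ℂ) (n : ℕ) : ℂ :=
  ∏ j ∈ range n, (1 - α * q ^ j) / (1 - q * q ^ j)

/-- The coefficient of `u ^ k` in `(∑ b n (t u) ^ n) (∑ b n (t / u) ^ n)`. -/
noncomputable def symmLaurentCoeff (b : ℕ → ℂ) (t : ℂ) (k : ℤ) : ℂ :=
  t ^ k.natAbs * ∑' m : ℕ, b m * b (m + k.natAbs) * (t ^ 2) ^ m

/-! ### Infinite `q`-products and the `q`-binomial theorem -/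

theorem norm_mul_pow_lt_one {q z : ℂ} (hq : ‖q‖ < 1) (hz : ‖z‖ < 1) (j : ℕ) :
    ‖z * q ^ j‖ < 1 := by
  rw [norm_mul, norm_pow]
  exact (mul_le_of_le_one_right (norm_nonneg z) (pow_le_one₀ (norm_nonneg q) hq.le)).trans_lt hz

theorem one_sub_ne_zero_of_norm_lt_one {z : ℂ} (hz : ‖z‖ < 1) : 1 - z ≠ 0 := by
  intro h
  rw [← sub_eq_zero.mp h] at hz
  simp at hz

theorem qPochInf_ne_zero {q z : ℂ} (hq : ‖q‖ < 1) (hz : ‖z‖ < 1) : qPochInf z q ≠ 0 := by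
  have h : Summable (fun j : ℕ => ‖-(z * q ^ j)‖) := by
    simpa [norm_mul, norm_pow] using
      (summable_geometric_of_lt_one (norm_nonneg q) hq).mul_left ‖z‖
  have := tprod_one_add_ne_zero_of_summable (f := fun j : ℕ => -(z * q ^ j))
    (fun j => by
      rw [← sub_eq_add_neg]
      exact one_sub_ne_zero_of_norm_lt_one (norm_mul_pow_lt_one hq hz j)) h
  simpa only [qPochInf, sub_eq_add_neg] using this

theorem qPochInf_eq_prod_mul {q : ℂ} (hq : ‖q‖ < 1) (z : ℂ) (n : ℕ) :
    qPochInf z q = (∏ j ∈ range n, (1 - z * q ^ j)) * qPochInf (z * q ^ n) q := by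
  have h : Multipliable (fun j : ℕ => 1 - z * q ^ (j + n)) := by
    simpa only [pow_add, mul_assoc, mul_comm] using multipliable_qPochInf (z * q ^ n) hq
  unfold qPochInf
  rw [← Multipliable.prod_mul_tprod_nat_mul' (f := fun j : ℕ => 1 - z * q ^ j) h]
  congr 1
  exact tprod_congr fun j => by ring

theorem tendsto_prod_qPochInf {q : ℂ} (hq : ‖q‖ < 1) (z : ℂ) :
    Tendsto (fun n => ∏ j ∈ range n, (1 - z * q ^ j)) atTop (𝓝 (qPochInf z q)) :=
  (multipliable_qPochInf z hq).tendsto_prod_tprod_nat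

theorem qBinomCoeff_eq_div (α q : ℂ) (n : ℕ) :
    qBinomCoeff α q n = (∏ j ∈ range n, (1 - α * q ^ j)) / ∏ j ∈ range n, (1 - q * q ^ j) :=
  prod_div_distrib _ _

theorem qBinomCoeff_zero (α q : ℂ) : qBinomCoeff α q 0 = 1 := by simp [qBinomCoeff]

theorem qBinomCoeff_succ {q : ℂ} (hq : ‖q‖ < 1) (α : ℂ) (n : ℕ) :
    qBinomCoeff α q (n + 1) * (1 - q ^ (n + 1)) = qBinomCoeff α q n * (1 - α * q ^ n) := by
  have h := one_sub_ne_zero_of_norm_lt_one (norm_mul_pow_lt_one hq hq n)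
  rw [qBinomCoeff, prod_range_succ, ← qBinomCoeff, pow_succ', mul_assoc, div_mul_cancel₀ _ h]

/-- Moves `n` into the arguments of infinite products, whose quotient the `q`-binomial theorem can
then expand as a series. -/
theorem qBinomCoeff_eq {q α : ℂ} (hq : ‖q‖ < 1) (hα : ‖α‖ < 1) (n : ℕ) :
    qBinomCoeff α q n =
      qPochInf α q / qPochInf q q * (qPochInf (q * q ^ n) q / qPochInf (α * q ^ n) q) := by
  have h1 := qPochInf_ne_zero hq hq
  have h2 := qPochInf_ne_zero hq (norm_mul_pow_lt_one hq hα n)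
  have h3 := qPochInf_ne_zero hq (norm_mul_pow_lt_one hq hq n)
  rw [qBinomCoeff_eq_div, qPochInf_eq_prod_mul hq α n, qPochInf_eq_prod_mul hq q n]
  rw [qPochInf_eq_prod_mul hq q n] at h1
  have h4 := left_ne_zero_of_mul h1
  field_simp

theorem exists_norm_qBinomCoeff_le {q : ℂ} (hq : ‖q‖ < 1) (α : ℂ) :
    ∃ C, ∀ n, ‖qBinomCoeff α q n‖ ≤ C := by
  have h := (tendsto_prod_qPochInf hq α).div (tendsto_prod_qPochInf hq q) (qPochInf_ne_zero hq hq)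
  obtain ⟨C, hC⟩ := (Metric.isBounded_range_of_tendsto _ h).exists_norm_le
  exact ⟨C, fun n => by
    rw [qBinomCoeff_eq_div]
    exact hC _ ⟨n, rfl⟩⟩

theorem summable_norm_qBinomCoeff_mul_pow {q x : ℂ} (hq : ‖q‖ < 1) (hx : ‖x‖ < 1) (α : ℂ) :
    Summable fun n => ‖qBinomCoeff α q n * x ^ n‖ := by
  obtain ⟨C, hC⟩ := exists_norm_qBinomCoeff_le hq α
  refine Summable.of_nonneg_of_le (fun _ => norm_nonneg _) (fun n => ?_)
    ((summable_geometric_of_lt_one (norm_nonneg x) hx).mul_left C)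
  rw [norm_mul, norm_pow]
  exact mul_le_mul_of_nonneg_right (hC n) (by positivity)

theorem tsum_qBinomCoeff_functional {q x : ℂ} (hq : ‖q‖ < 1) (hx : ‖x‖ < 1) (α : ℂ) :
    (1 - x) * ∑' n, qBinomCoeff α q n * x ^ n =
      (1 - α * x) * ∑' n, qBinomCoeff α q n * (x * q) ^ n := by
  have hxq : ‖x * q‖ < 1 := by simpa using norm_mul_pow_lt_one hq hx 1
  have h1 := (summable_norm_qBinomCoeff_mul_pow hq hx α).of_norm
  have h2 := (summable_norm_qBinomCoeff_mul_pow hq hxq α).of_norm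
  have h3 : ∑' n, qBinomCoeff α q n * x ^ n - ∑' n, qBinomCoeff α q n * (x * q) ^ n =
      x * ∑' n, qBinomCoeff α q n * x ^ n - α * x * ∑' n, qBinomCoeff α q n * (x * q) ^ n := by
    -- The difference has coefficients `b n (1 - q^n)`: its `n = 0` term vanishes, and the
    -- recurrence rewrites the rest after a shift.
    rw [← h1.tsum_sub h2, (h1.sub h2).tsum_eq_zero_add, ← tsum_mul_left, ← tsum_mul_left,
      ← (h1.mul_left _).tsum_sub (h2.mul_left _)]
    simp only [pow_zero, sub_self, zero_add]
    refine tsum_congr fun n => ?_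
    linear_combination x ^ (n + 1) * qBinomCoeff_succ hq α n
  linear_combination h3

/-- The `q`-binomial theorem. -/
theorem tsum_qBinomCoeff_mul_pow {q x : ℂ} (hq : ‖q‖ < 1) (hx : ‖x‖ < 1) (α : ℂ) :
    ∑' n, qBinomCoeff α q n * x ^ n = qPochInf (α * x) q / qPochInf x q := by
  set f : ℂ → ℂ := fun y => ∑' n, qBinomCoeff α q n * y ^ n with hf
  have hiter : ∀ N : ℕ, (∏ j ∈ range N, (1 - x * q ^ j)) * f x =
      (∏ j ∈ range N, (1 - α * x * q ^ j)) * f (x * q ^ N) := by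
    intro N
    induction N with
    | zero => simp
    | succ N ih =>
      have h := tsum_qBinomCoeff_functional hq (norm_mul_pow_lt_one hq hx N) α
      rw [mul_assoc x, ← pow_succ] at h
      rw [prod_range_succ, prod_range_succ]
      linear_combination (1 - x * q ^ N) * ih + (∏ j ∈ range N, (1 - α * x * q ^ j)) * h
  -- As `x q^N → 0` only the term `n = 0` survives; the series at `x` dominates.
  have hlim : Tendsto (fun N : ℕ => f (x * q ^ N)) atTop (𝓝 1) := by
    have h0 : ∑' n : ℕ, (if n = 0 then (1 : ℂ) else 0) = 1 := tsum_ite_eq 0 _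
    rw [← h0]
    refine tendsto_tsum_of_dominated_convergence (summable_norm_qBinomCoeff_mul_pow hq hx α)
      (fun n => ?_) (Eventually.of_forall fun N n => ?_)
    · rcases eq_or_ne n 0 with rfl | hn
      · simp [qBinomCoeff_zero]
      · have h : Tendsto (fun N : ℕ => x * q ^ N) atTop (𝓝 0) := by
          simpa using (tendsto_pow_atTop_nhds_zero_of_norm_lt_one hq).const_mul x
        simpa [hn] using (h.pow n).const_mul (qBinomCoeff α q n)
    · rw [norm_mul, norm_mul, norm_pow, norm_pow]
      gcongr
      rw [norm_mul, norm_pow]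
      exact mul_le_of_le_one_right (norm_nonneg x) (pow_le_one₀ (norm_nonneg q) hq.le)
  have h1 := (tendsto_prod_qPochInf hq x).mul_const (f x)
  simp only [hiter] at h1
  have h2 := tendsto_nhds_unique h1 ((tendsto_prod_qPochInf hq (α * x)).mul hlim)
  rw [eq_div_iff (qPochInf_ne_zero hq hx)]
  linear_combination h2

/-! ### Laurent coefficients and contour integrals -/

/-- Pairs of naturals, indexed by their difference and their minimum. -/
def intProdNatEquiv : ℤ × ℕ ≃ ℕ × ℕ where
  toFun p := (p.2 + p.1.toNat, p.2 + (-p.1).toNat)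
  invFun p := ((p.1 : ℤ) - p.2, min p.1 p.2)
  left_inv p := by
    ext <;> simp
    omega
  right_inv p := by
    ext <;> simp <;> omega

/-- The double series converges absolutely, so it may be regrouped by the difference of the two
exponents. -/
theorem hasSum_symmLaurentCoeff {b : ℕ → ℂ} {t u : ℂ} (hu : u ≠ 0)
    (h1 : Summable fun n => ‖b n * (t * u) ^ n‖) (h2 : Summable fun n => ‖b n * (t * u⁻¹) ^ n‖) :
    HasSum (fun k : ℤ => symmLaurentCoeff b t k * u ^ k)
      ((∑' n, b n * (t * u) ^ n) * ∑' n, b n * (t * u⁻¹) ^ n) := by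
  have hs := summable_mul_of_summable_norm h1 h2
  have h := hs.hasSum
  rw [← tsum_mul_tsum_of_summable_norm h1 h2, ← intProdNatEquiv.hasSum_iff] at h
  have h' := h.prod_fiberwise fun k => (h.summable.prod_factor k).hasSum
  refine (congrArg (HasSum · _) (funext fun k => ?_)).mpr h'
  rw [symmLaurentCoeff, mul_right_comm, ← tsum_mul_left]
  refine tsum_congr fun m => ?_
  obtain ⟨n, rfl | rfl⟩ := k.eq_nat_or_neg
  · have e : u ^ (m + n) * u⁻¹ ^ m = u ^ n := by
      rw [pow_add, mul_right_comm, ← mul_pow, mul_inv_cancel₀ hu, one_pow, one_mul]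
    simp only [intProdNatEquiv, Function.comp, Equiv.coe_fn_mk, Int.natAbs_natCast, zpow_natCast,
      Int.toNat_natCast, Int.toNat_neg_natCast, add_zero, mul_pow]
    rw [← e]
    ring
  · have e : u ^ m * u⁻¹ ^ (m + n) = u⁻¹ ^ n := by
      rw [pow_add, ← mul_assoc, ← mul_pow, mul_inv_cancel₀ hu, one_pow, one_mul]
    simp only [intProdNatEquiv, Function.comp, Equiv.coe_fn_mk, Int.natAbs_neg,
      Int.natAbs_natCast, zpow_neg, zpow_natCast, neg_neg,
      Int.toNat_natCast, Int.toNat_neg_natCast, add_zero, mul_pow]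
    rw [← inv_pow, ← e]
    ring

theorem circleIntegral_zpow_div (k : ℤ) :
    (2 * π * Complex.I)⁻¹ * ∮ z in C(0, 1), z ^ k / z = if k = 0 then 1 else 0 := by
  split_ifs with hk
  · have h := circleIntegral.integral_sub_center_inv (0 : ℂ) one_ne_zero
    simp only [sub_zero] at h
    simp only [hk, zpow_zero, one_div, h]
    exact inv_mul_cancel₀ Complex.two_pi_I_ne_zero
  · have h := circleIntegral.integral_sub_zpow_of_ne (n := k - 1) (by omega) 0 0 1
    have h' : (∮ z in C(0, 1), z ^ k / z) = ∮ z in C(0, 1), (z - 0) ^ (k - 1) := by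
      refine circleIntegral.integral_congr zero_le_one fun z hz => ?_
      have hz0 : z ≠ 0 := ne_zero_of_mem_unit_sphere ⟨z, hz⟩
      simp [zpow_sub_one₀ hz0, div_eq_mul_inv]
    rw [h', h, mul_zero]

/-- On `|z| = 1` the series converges uniformly by the Weierstrass test, so it is integrated
termwise. -/
theorem circleIntegral_of_hasSum_zpow {d : ℤ → ℂ} {f : ℂ → ℂ} (hd : Summable fun k => ‖d k‖)
    (hf : ∀ z ∈ Metric.sphere (0 : ℂ) 1, HasSum (fun k => d k * z ^ k) (f z)) :
    CircleIntegrable (fun z => f z / z) 0 1 ∧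
      (2 * π * Complex.I)⁻¹ * ∮ z in C(0, 1), f z / z = d 0 := by
  have hne : ∀ z ∈ Metric.sphere (0 : ℂ) 1, z ≠ 0 := fun z hz =>
    ne_zero_of_mem_unit_sphere ⟨z, hz⟩
  have hcont : ∀ k : ℤ, ContinuousOn (fun z : ℂ => d k * z ^ k / z) (Metric.sphere 0 1) := by
    intro k z hz
    exact ((continuousAt_const.mul (continuousAt_zpow₀ z k (Or.inl (hne z hz)))).div
      continuousAt_id (hne z hz)).continuousWithinAt
  have hbound : ∀ (k : ℤ), ∀ z ∈ Metric.sphere (0 : ℂ) 1, ‖d k * z ^ k / z‖ ≤ ‖d k‖ := by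
    intro k z hz
    have : ‖z‖ = 1 := by simpa using hz
    simp [this]
  have heq : Set.EqOn (fun z => ∑' k, d k * z ^ k / z) (fun z => f z / z)
      (Metric.sphere (0 : ℂ) 1) := fun z hz => ((hf z hz).div_const z).tsum_eq
  have hfc : ContinuousOn (fun z => f z / z) (Metric.sphere (0 : ℂ) 1) :=
    (continuousOn_tsum hcont hd hbound).congr heq.symm
  refine ⟨hfc.circleIntegrable zero_le_one, ?_⟩
  have hunif := (tendstoUniformlyOn_tsum hd hbound).congr_right heq
  have hlim := hunif.tendsto_circleIntegral_of_continuousOn zero_le_one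
    (Eventually.of_forall fun s => continuousOn_finsetSum s fun k _ => hcont k)
  have hsum : HasSum (fun k => ∮ z in C(0, 1), d k * z ^ k / z) (∮ z in C(0, 1), f z / z) := by
    refine hlim.congr fun s => ?_
    exact circleIntegral.integral_fun_sum fun k _ => (hcont k).circleIntegrable zero_le_one
  have hval : ∀ k, (2 * π * Complex.I)⁻¹ * (∮ z in C(0, 1), d k * z ^ k / z) =
      if k = 0 then d 0 else 0 := by
    intro k
    simp only [mul_div_assoc]
    rw [circleIntegral.integral_const_mul, mul_left_comm, circleIntegral_zpow_div]
    split_ifs with hk <;> simp [hk]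
  have hsum' := hsum.mul_left (2 * π * Complex.I)⁻¹
  simp only [hval] at hsum'
  exact hsum'.unique (hasSum_ite_eq 0 (d 0))

/-! ### Heine's transformation and the two indices -/

/-- A case of Heine's transformation of `₂φ₁` series. -/
theorem tsum_qBinomCoeff_sq {q a : ℂ} (hq : ‖q‖ < 1) (ha : ‖a‖ < 1) (hqa : ‖q‖ < ‖a‖) (k : ℕ) :
    ∑' n, qBinomCoeff a q n * qBinomCoeff a q n * (q / a * q ^ k) ^ n =
      qPochInf a q / qPochInf (q / a) q *
        ∑' m, qBinomCoeff (q / a) q m * qBinomCoeff (q / a) q (m + k) * a ^ m := by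
  have ha0 : a ≠ 0 := norm_pos_iff.mp ((norm_nonneg q).trans_lt hqa)
  have hqa1 : ‖q / a‖ < 1 := by
    rw [norm_div]
    exact (div_lt_one (norm_pos_iff.mpr ha0)).mpr hqa
  have hqq := qPochInf_ne_zero hq hq
  have hqaP := qPochInf_ne_zero hq hqa1
  have hy : ‖q / a * q ^ k‖ < 1 := norm_mul_pow_lt_one hq hqa1 k
  set y := q / a * q ^ k with hy_def
  -- Both sides are the same double series, coupled only by `q^(n m)`: summing over `m` first gives
  -- the left side, over `n` first the right.
  have hleft : ∀ n, qBinomCoeff a q n * qBinomCoeff a q n * y ^ n = ∑' m,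
      qPochInf a q / qPochInf q q *
        (qBinomCoeff a q n * y ^ n * (qBinomCoeff (q / a) q m * a ^ m) * q ^ (n * m)) := by
    intro n
    have h := tsum_qBinomCoeff_mul_pow hq (norm_mul_pow_lt_one hq ha n) (q / a)
    rw [← mul_assoc, div_mul_cancel₀ q ha0] at h
    nth_rw 1 [qBinomCoeff_eq hq ha n]
    rw [← h, mul_assoc, mul_assoc, ← tsum_mul_right, ← tsum_mul_left]
    refine tsum_congr fun m => ?_
    rw [mul_pow, ← pow_mul]
    ring
  have hright : ∀ m, qPochInf a q / qPochInf (q / a) q *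
      (qBinomCoeff (q / a) q m * qBinomCoeff (q / a) q (m + k) * a ^ m) = ∑' n,
      qPochInf a q / qPochInf q q *
        (qBinomCoeff a q n * y ^ n * (qBinomCoeff (q / a) q m * a ^ m) * q ^ (n * m)) := by
    intro m
    have h := tsum_qBinomCoeff_mul_pow hq (norm_mul_pow_lt_one hq hy m) a
    have e1 : a * (y * q ^ m) = q * q ^ (m + k) := by
      rw [hy_def, pow_add]
      field_simp
    have e2 : y * q ^ m = q / a * q ^ (m + k) := by
      rw [hy_def, pow_add]
      ring
    rw [e1] at h
    have h4 : ∑' n, qPochInf a q / qPochInf q q *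
        (qBinomCoeff a q n * y ^ n * (qBinomCoeff (q / a) q m * a ^ m) * q ^ (n * m)) =
        qPochInf a q / qPochInf q q * (qBinomCoeff (q / a) q m * a ^ m) *
          ∑' n, qBinomCoeff a q n * (y * q ^ m) ^ n := by
      rw [← tsum_mul_left]
      refine tsum_congr fun n => ?_
      rw [mul_pow y, ← pow_mul, mul_comm m n]
      ring
    rw [h4, h, e2, qBinomCoeff_eq hq hqa1 (m + k)]
    field_simp
  have hsum : Summable (Function.uncurry fun n m : ℕ => qPochInf a q / qPochInf q q *
      (qBinomCoeff a q n * y ^ n * (qBinomCoeff (q / a) q m * a ^ m) * q ^ (n * m))) := by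
    -- Since `|q^(n m)| ≤ 1`, a product of two absolutely convergent series dominates.
    refine Summable.mul_left _ (Summable.of_norm_bounded (summable_mul_of_summable_norm
      (summable_norm_qBinomCoeff_mul_pow hq hy a).norm
      (summable_norm_qBinomCoeff_mul_pow hq ha (q / a)).norm) fun p => ?_)
    rw [norm_mul, norm_mul, norm_pow]
    exact mul_le_of_le_one_right (by positivity) (pow_le_one₀ (norm_nonneg q) hq.le)
  simp only [hleft]
  rw [← hsum.tsum_comm, ← tsum_mul_left]
  exact (tsum_congr hright).symm

theorem electricIntegrand_circleIntegral {q a s r : ℂ} (hq : ‖q‖ < 1) (hs : s ^ 2 = q)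
    (hr : r ^ 2 = a) (hqa : ‖q‖ < ‖a‖) (k : ℤ) :
    CircleIntegrable (fun z => electricIntegrand q s r k z / z) 0 1 ∧
      (2 * π * Complex.I)⁻¹ * ∮ z in C(0, 1), electricIntegrand q s r k z / z =
        ∑' n, qBinomCoeff a q n * qBinomCoeff a q n * (q / a * q ^ k.natAbs) ^ n := by
  have hr0 : r ≠ 0 := by
    rintro rfl
    rw [← hr] at hqa
    simp at hqa
    exact absurd hqa (norm_nonneg q).not_gt
  have hs1 : ‖s‖ < 1 := by
    rw [← hs, norm_pow] at hq
    exact (pow_lt_one_iff_of_nonneg (norm_nonneg s) two_ne_zero).mp hq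
  have hsr : ‖r⁻¹ * s‖ < 1 := by
    rw [← hs, ← hr, norm_pow, norm_pow] at hqa
    rw [norm_mul, norm_inv, inv_mul_lt_one₀ (norm_pos_iff.mpr hr0)]
    exact lt_of_pow_lt_pow_left₀ 2 (norm_nonneg r) hqa
  set t := r⁻¹ * s ^ (1 + k.natAbs) with ht_def
  have ht : ‖t‖ < 1 := by
    rw [ht_def, pow_add, pow_one, ← mul_assoc]
    exact norm_mul_pow_lt_one hs1 hsr _
  have ht2 : t ^ 2 = q / a * q ^ k.natAbs := by
    rw [ht_def, ← hs, ← hr]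
    field_simp
    ring
  have hat : r * s ^ (1 + k.natAbs) = a * t := by
    rw [ht_def, ← hr]
    field_simp
  have hd : Summable fun j => ‖symmLaurentCoeff (qBinomCoeff a q) t j‖ := by
    have h := summable_norm_qBinomCoeff_mul_pow hq ht a
    -- At `u = 1` the Laurent series is the series of its coefficients.
    simpa using (hasSum_symmLaurentCoeff (b := qBinomCoeff a q) (t := t) one_ne_zero
      (by simpa using h) (by simpa using h)).summable.norm
  have hmain := circleIntegral_of_hasSum_zpow hd (f := electricIntegrand q s r k) fun z hz => by
    have hz1 : ‖z‖ = 1 := by simpa using hz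
    have hz0 : z ≠ 0 := ne_zero_of_mem_unit_sphere ⟨z, hz⟩
    have h1 : ‖t * z‖ < 1 := by simpa [hz1] using ht
    have h2 : ‖t * z⁻¹‖ < 1 := by simpa [hz1] using ht
    have h := hasSum_symmLaurentCoeff hz0 (summable_norm_qBinomCoeff_mul_pow hq h1 a)
      (summable_norm_qBinomCoeff_mul_pow hq h2 a)
    rw [tsum_qBinomCoeff_mul_pow hq h1, tsum_qBinomCoeff_mul_pow hq h2, div_mul_div_comm,
      ← mul_assoc a t z, ← mul_assoc a t z⁻¹, ← hat] at h
    exact h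
  refine ⟨hmain.1, hmain.2.trans ?_⟩
  simp [symmLaurentCoeff, ht2]

theorem mainTheorem4 (q a w s r : ℂ) (hq : ‖q‖ < 1) (hs : s ^ 2 = q) (hr : r ^ 2 = a)
    (hqa : ‖q‖ < ‖a‖) (hw : w ≠ 0) (hrw : ‖r * w‖ < 1) (hrw' : ‖r * w⁻¹‖ < 1) :
    (∀ k : ℤ, CircleIntegrable (fun z => electricIntegrand q s r k z / z) 0 1) ∧
      Summable (electricTerm q s r w) ∧
      electricIndex q s r w = mirrorIndex q a r w := by
  -- The two bounds involving `w` multiply to one on `a`, as Heine's transformation needs.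
  have ha : ‖a‖ < 1 := by
    have e : a = r * w * (r * w⁻¹) := by
      rw [← hr]
      field_simp
    rw [e, norm_mul]
    exact mul_lt_one_of_nonneg_of_lt_one_left (norm_nonneg _) hrw hrw'.le
  have hr0 : r ≠ 0 := by
    rintro rfl
    rw [← hr] at hqa
    simp at hqa
    exact absurd hqa (norm_nonneg q).not_gt
  have hterm : ∀ k, electricTerm q s r w k = qPochInf a q / qPochInf (q / a) q *
      (symmLaurentCoeff (qBinomCoeff (q / a) q) r k * w ^ k) := by
    intro k
    rw [electricTerm, (electricIntegrand_circleIntegral hq hs hr hqa k).2,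
      tsum_qBinomCoeff_sq hq ha hqa, symmLaurentCoeff, hr]
    ring
  have hsum := (hasSum_symmLaurentCoeff hw (summable_norm_qBinomCoeff_mul_pow hq hrw (q / a))
    (summable_norm_qBinomCoeff_mul_pow hq hrw' (q / a))).mul_left
      (qPochInf a q / qPochInf (q / a) q)
  simp only [← hterm] at hsum
  have hqr : q / a * r = q / r := by
    rw [← hr]
    field_simp
  rw [tsum_qBinomCoeff_mul_pow hq hrw, tsum_qBinomCoeff_mul_pow hq hrw', div_mul_div_comm,
    ← mul_assoc (q / a), ← mul_assoc (q / a), hqr] at hsum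
  exact ⟨fun k => (electricIntegrand_circleIntegral hq hs hr hqa k).1, hsum.summable,
    hsum.tsum_eq⟩
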